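/- For finite simple graphs $G, G_1, G_2$ write $G\to(G_1,G_2)$ if in every colouring of the edges of $G$ with two colours, the spanning subgraph of $G$ formed by the edges of the first colour contains a copy of $G_1$ or the one formed by the edges of the second colour contains a copy of $G_2$. Let $R(G_1,G_2)$ be the smallest positive integer $n$ with $K_n\to(G_1,G_2)$, and, with $r=R(G_1,G_2)$, let the star-critical Ramsey number be $R_*(G_1,G_2)=\min\{\delta(H): H\subseteq K_r,\ H\to(G_1,G_2)\}$, where $\delta(H)$ is the minimum degree of $H$. For a forest $F$, let $n(F)$ be the number of vertices of a largest component of $F$, let $k_i(F)$ be the number of components of $F$ with exactly $i$ vertices, and let $C(F)=\{i: k_i(F)\neq 0\}$. **Theorem.** Let $F$ be a (finite, nonempty) forest without isolated vertices, let $m\ge 3$ be an integer, and let $j_0$ be the smallest $j\in C(F)$ that attains $$\max_{j\in C(F)}\Big\{(j-1)(m-2)+\sum_{i=j}^{n(F)} i\,k_i(F)\Big\}.$$ Then $$R_*(F,K_m)=(j_0-1)(m-3)+\sum_{i=j_0}^{n(F)} i\,k_i(F).$$ -/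

import Mathlib

namespace ForestRamsey

/-- `G → (G₁, G₂)`: in every colouring of the edges of `G` with two colours, the spanning subgraph
formed by the edges of the first colour contains a copy of `G₁`, or the one formed by the edges of
the second colour contains a copy of `G₂`. -/
def Arrows {V W₁ W₂ : Type*} (G : SimpleGraph V) (G₁ : SimpleGraph W₁) (G₂ : SimpleGraph W₂) :
    Prop :=
  ∀ c : G.EdgeLabeling (Fin 2),
    G₁.IsContained (c.labelGraph 0) ∨ G₂.IsContained (c.labelGraph 1)

/-- `r = R(G₁, G₂)`: `r` is the smallest positive integer `n` with `K_n → (G₁, G₂)`. -/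
def IsRamseyNumber {W₁ W₂ : Type*} (G₁ : SimpleGraph W₁) (G₂ : SimpleGraph W₂) (r : ℕ) : Prop :=
  IsLeast {n : ℕ | 0 < n ∧ Arrows (⊤ : SimpleGraph (Fin n)) G₁ G₂} r

open Classical in
/-- The set of all `δ(H)`, where `H` is a subgraph of `K_r` (not necessarily spanning or induced)
with `H → (G₁, G₂)`. -/
noncomputable def arrowingMinDegrees {W₁ W₂ : Type*} (G₁ : SimpleGraph W₁) (G₂ : SimpleGraph W₂)
    (r : ℕ) : Set ℕ :=
  {d : ℕ | ∃ H : (⊤ : SimpleGraph (Fin r)).Subgraph, Arrows H.coe G₁ G₂ ∧ H.coe.minDegree = d}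

/-- `s = R_*(G₁, G₂)`: with `r = R(G₁, G₂)`, the number `s` is the minimum of `δ(H)` over the
subgraphs `H` of `K_r` with `H → (G₁, G₂)`. Both minima are required to be attained, so there are
no default values. -/
def IsStarCriticalRamseyNumber {W₁ W₂ : Type*} (G₁ : SimpleGraph W₁) (G₂ : SimpleGraph W₂)
    (s : ℕ) : Prop :=
  ∃ r : ℕ, IsRamseyNumber G₁ G₂ r ∧ IsLeast (arrowingMinDegrees G₁ G₂ r) s

/-- `k_i(F)`: the number of connected components of `F` with exactly `i` vertices. -/
noncomputable def numComponents {V : Type*} (F : SimpleGraph V) (i : ℕ) : ℕ :=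
  {c : F.ConnectedComponent | c.supp.ncard = i}.ncard

/-- `n(F)`: the number of vertices of a largest connected component of `F`. -/
noncomputable def maxComponentSize {V : Type*} (F : SimpleGraph V) : ℕ :=
  ⨆ c : F.ConnectedComponent, c.supp.ncard

/-- `C(F)`: the set of all `i` with `k_i(F) ≠ 0`. -/
def componentSizes {V : Type*} (F : SimpleGraph V) : Set ℕ :=
  {i : ℕ | numComponents F i ≠ 0}

/-- The sum of `i * k_i(F)` over `j ≤ i ≤ n(F)`. -/
noncomputable def tailSum {V : Type*} (F : SimpleGraph V) (j : ℕ) : ℕ :=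
  ∑ i ∈ Finset.Icc j (maxComponentSize F), i * numComponents F i

/-- `j₀` is the smallest `j ∈ C(F)` that realizes the maximum over `C(F)` of
`(j - 1)(m - 2) + ∑_{i=j}^{n(F)} i k_i(F)`. (Every `j ∈ C(F)` is at least `1`; the subtractions
are not truncated when `m ≥ 2`.) -/
def IsSmallestMaximizer {V : Type*} (F : SimpleGraph V) (m j₀ : ℕ) : Prop :=
  IsLeast {j : ℕ | j ∈ componentSizes F ∧
    IsMaxOn (fun j : ℕ => (j - 1) * (m - 2) + tailSum F j) (componentSizes F) j} j₀

end ForestRamsey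

open SimpleGraph

namespace ForestRamsey

/-! Let t be the sum of i k_i over i ≥ j₀ and r = (j₀-1)(m-2) + t. Then r is the Ramsey number, and
the star-critical number is r - (j₀-1). Call the two colours red and blue.

Upper bound: delete j₀-2 edges at one vertex v of K_r, assume there is no blue K_m, and place the
components of F in red by decreasing size. When a component on j vertices is due, maximality of r
leaves at least (j-1)(m-1)+1 free vertices, which is Chvátal's bound for trees. If j is not a
maximizer there is a vertex to spare, and v can be discarded. If it is, then j ≥ j₀, so v misses at
most j-2 edges, and `exists_embedsOn_of_card_of_missing` tolerates that.

Lower bound (`not_arrows_of_partition`): split r-1 vertices into m-2 parts of size j₀-1 and one of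
size t-1, red inside parts and blue across. Components with at least j₀ vertices fit only in the
last part, which is too small for all of them. In a graph on r vertices, a vertex u of degree below
r-(j₀-1) has j₀-1 non-neighbours; with these as one part, u joins that part without any edge inside
it. -/

/-! ### Partial embeddings and connected vertex sets in forests -/

/-- `f` embeds the subgraph of `F` induced on `A` into the subgraph of `R` induced on `S`. -/
structure EmbedsOn {V U : Type*} (F : SimpleGraph V) (R : SimpleGraph U) (A : Finset V)
    (S : Finset U) (f : V → U) : Prop where
  mapsTo : ∀ x ∈ A, f x ∈ S
  injOn : Set.InjOn f A
  adj : ∀ x ∈ A, ∀ y ∈ A, F.Adj x y → R.Adj (f x) (f y)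

-- The extension step for every tree embedding below: a new vertex attached to a connected part of a
-- forest has one neighbour there, so `hadj` is then a single condition.
open Classical in
theorem EmbedsOn.update {V U : Type*} {F : SimpleGraph V} {R : SimpleGraph U} {A : Finset V}
    {S T : Finset U} {f : V → U} (h : EmbedsOn F R A S f) (hST : S ⊆ T) {b : V} (hb : b ∉ A)
    {u : U} (hu : u ∈ T) (hfu : ∀ x ∈ A, f x ≠ u) (hadj : ∀ x ∈ A, F.Adj x b → R.Adj (f x) u) :
    EmbedsOn F R (insert b A) T (Function.update f b u) := by
  have key : ∀ x ∈ A, Function.update f b u x = f x := fun x hx =>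
    Function.update_of_ne (ne_of_mem_of_not_mem hx hb) _ _
  have keyb : Function.update f b u b = u := Function.update_self ..
  refine ⟨fun x hx => ?_, fun x hx y hy hxy => ?_, fun x hx y hy hxy => ?_⟩
  · rcases Finset.mem_insert.1 hx with rfl | hx
    · rwa [keyb]
    · rw [key x hx]; exact hST (h.mapsTo x hx)
  · rcases Finset.mem_insert.1 (Finset.mem_coe.1 hx) with rfl | hx' <;>
      rcases Finset.mem_insert.1 (Finset.mem_coe.1 hy) with rfl | hy'
    · rfl
    · rw [keyb, key y hy'] at hxy; exact (hfu y hy' hxy.symm).elim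
    · rw [keyb, key x hx'] at hxy; exact (hfu x hx' hxy).elim
    · rw [key x hx', key y hy'] at hxy; exact h.injOn hx' hy' hxy
  · rcases Finset.mem_insert.1 hx with rfl | hx' <;> rcases Finset.mem_insert.1 hy with rfl | hy'
    · exact (hxy.ne rfl).elim
    · rw [keyb, key y hy']; exact (hadj y hy' hxy.symm).symm
    · rw [keyb, key x hx']; exact hadj x hx' hxy
    · rw [key x hx', key y hy']; exact h.adj x hx' y hy' hxy

theorem EmbedsOn.mono {V U : Type*} {F : SimpleGraph V} {R : SimpleGraph U} {A : Finset V}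
    {S T : Finset U} {f : V → U} (h : EmbedsOn F R A S f) (hST : S ⊆ T) : EmbedsOn F R A T f :=
  ⟨fun x hx => hST (h.mapsTo x hx), h.injOn, h.adj⟩

theorem EmbedsOn.card_image {V U : Type*} [DecidableEq U] {F : SimpleGraph V} {R : SimpleGraph U}
    {A : Finset V} {S : Finset U} {f : V → U} (h : EmbedsOn F R A S f) :
    (A.image f).card = A.card :=
  Finset.card_image_of_injOn h.injOn

/-- A connected set of vertices has an edge leaving any proper nonempty subset. -/
theorem exists_adj_of_ssubset {V : Type*} {F : SimpleGraph V} {A B : Finset V}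
    (hA : (F.induce (A : Set V)).Connected) (hB : B.Nonempty) (hBA : B ⊂ A) :
    ∃ a ∈ B, ∃ b ∈ A, b ∉ B ∧ F.Adj a b := by
  obtain ⟨x, hx⟩ := hB
  obtain ⟨hsub, y, hyA, hyB⟩ := Finset.ssubset_iff_exists_cons_subset.1 hBA |>.elim
    fun y h => h.elim fun hy hs => (⟨hBA.1, y, hs (by simp), hy⟩ : B ⊆ A ∧ ∃ y, y ∈ A ∧ y ∉ B)
  obtain ⟨p⟩ := hA.preconnected ⟨x, hsub hx⟩ ⟨y, hyA⟩
  obtain ⟨d, -, h1, h2⟩ := p.exists_boundary_dart {z | z.1 ∈ B} hx hyB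
  exact ⟨d.fst.1, h1, d.snd.1, d.snd.2, h2, d.adj⟩

open Classical in
theorem connected_induce_insert {V : Type*} {F : SimpleGraph V} {B : Finset V}
    (hB : (F.induce (B : Set V)).Connected) {a b : V} (ha : a ∈ B) (hab : F.Adj a b) :
    (F.induce ((insert b B : Finset V) : Set V)).Connected := by
  have h := connected_induce_union (G := F) (s := (B : Set V)) (t := {b}) hB.preconnected
    Preconnected.of_subsingleton ha rfl hab
  rw [Finset.coe_insert, Set.insert_eq, Set.union_comm]
  exact h

theorem connected_induce_singleton {V : Type*} (F : SimpleGraph V) (a : V) :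
    (F.induce (({a} : Finset V) : Set V)).Connected := by
  have : Subsingleton (({a} : Finset V) : Set V) := by
    simp only [Finset.coe_singleton]; infer_instance
  have : Nonempty (({a} : Finset V) : Set V) := ⟨⟨a, by simp⟩⟩
  exact ⟨SimpleGraph.Preconnected.of_subsingleton⟩

/-- In an acyclic graph, a vertex outside a connected set has at most one neighbour in it. -/
theorem eq_of_adj_of_adj {V : Type*} {F : SimpleGraph V} (hF : F.IsAcyclic) {A : Set V}
    (hA : (F.induce A).Connected) {b : V} (hb : b ∉ A) {x y : V} (hx : x ∈ A) (hy : y ∈ A)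
    (hxb : F.Adj x b) (hyb : F.Adj y b) : x = y := by
  obtain ⟨p, hp⟩ := hA.exists_isPath ⟨x, hx⟩ ⟨y, hy⟩
  have hb' : b ∉ (p.map (Embedding.induce A).toHom).support := by
    rw [Walk.support_map]
    intro h
    obtain ⟨z, -, rfl⟩ := List.mem_map.1 h
    exact hb z.2
  have hp' : (p.map (Embedding.induce A).toHom).IsPath :=
    Walk.IsPath.map (Embedding.induce (G := F) A).injective hp
  have hq : (Walk.cons hxb.symm (p.map (Embedding.induce A).toHom)).IsPath :=
    hp'.cons hb'
  have := hF.eq_snd_of_adj_start hq hyb.symm (Walk.end_mem_support _)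
  exact (this.trans (Walk.snd_cons _ _)).symm

/-! ### Trees in two-coloured graphs -/

/-- Greedy embedding of a tree, with a prescribed image for one vertex. -/
theorem exists_embedsOn_of_degree {V U : Type*} {F : SimpleGraph V} (hF : F.IsAcyclic)
    {R : SimpleGraph U} [DecidableRel R.Adj] {A : Finset V}
    (hA : (F.induce (A : Set V)).Connected) {S : Finset U}
    (hdeg : ∀ u ∈ S, A.card ≤ (S.filter (R.Adj u)).card + 1) {y : V} (hy : y ∈ A) {w : U}
    (hw : w ∈ S) : ∃ f : V → U, EmbedsOn F R A S f ∧ f y = w := by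
  classical
  suffices H : ∀ n, n + 1 ≤ A.card → ∃ B ⊆ A, B.card = n + 1 ∧ y ∈ B ∧
      (F.induce (B : Set V)).Connected ∧ ∃ f : V → U, EmbedsOn F R B S f ∧ f y = w by
    have hpos := Finset.card_pos.2 ⟨y, hy⟩
    obtain ⟨B, hBA, hcard, -, -, f, hf⟩ := H (A.card - 1) (by lia)
    obtain rfl := Finset.eq_of_subset_of_card_le hBA (by lia)
    exact ⟨f, hf⟩
  intro n
  induction n with
  | zero =>
    intro _
    refine ⟨{y}, by simpa, rfl, by simp, connected_induce_singleton F y, fun _ => w,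
      ⟨fun _ _ => hw, ?_, ?_⟩, rfl⟩
    · simp
    · intro x hx z hz h
      rw [Finset.mem_singleton.1 hx, Finset.mem_singleton.1 hz] at h
      exact (h.ne rfl).elim
  | succ n ih =>
    intro hn
    obtain ⟨B, hBA, hcard, hyB, hBc, f, hf, hfy⟩ := ih (by lia)
    have hss : B ⊂ A := Finset.ssubset_iff_subset_ne.2 ⟨hBA, by rintro rfl; lia⟩
    obtain ⟨a, ha, b, hbA, hbB, hab⟩ := exists_adj_of_ssubset hA ⟨y, hyB⟩ hss
    -- `f a` is not its own neighbour, so only the other `B.card - 1` images have to be avoided.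
    obtain ⟨u, hu, huf⟩ : ∃ u ∈ S.filter (R.Adj (f a)), u ∉ (B.erase a).image f := by
      apply Finset.exists_mem_notMem_of_card_lt_card
      have h1 := hdeg (f a) (hf.mapsTo a ha)
      have h2 : ((B.erase a).image f).card ≤ (B.erase a).card := Finset.card_image_le
      rw [Finset.card_erase_of_mem ha] at h2
      lia
    rw [Finset.mem_filter] at hu
    refine ⟨insert b B, Finset.insert_subset hbA hBA, ?_, Finset.mem_insert_of_mem hyB,
      connected_induce_insert hBc ha hab, Function.update f b u,
      hf.update subset_rfl hbB hu.1 ?_ ?_, ?_⟩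
    · rw [Finset.card_insert_of_notMem hbB, hcard]
    · rintro x hx rfl
      by_cases hxa : x = a
      · subst hxa; exact hu.2.ne rfl
      · exact huf (Finset.mem_image_of_mem f (Finset.mem_erase.2 ⟨hxa, hx⟩))
    · intro x hx hxb
      rw [eq_of_adj_of_adj hF hBc (by simpa using hbB) hx ha hxb hab]
      exact hu.2
    · rw [Function.update_of_ne (ne_of_mem_of_not_mem hyB hbB), hfy]

/-- A connected set of vertices has connected subsets of every smaller positive size. -/
theorem exists_connected_subset_card {V : Type*} {F : SimpleGraph V} {A : Finset V}
    (hA : (F.induce (A : Set V)).Connected) (n : ℕ) (hn : n + 1 ≤ A.card) :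
    ∃ B ⊆ A, B.card = n + 1 ∧ (F.induce (B : Set V)).Connected := by
  classical
  induction n with
  | zero =>
    obtain ⟨⟨a, ha⟩⟩ := hA.nonempty
    exact ⟨{a}, by simpa using ha, rfl, connected_induce_singleton F a⟩
  | succ n ih =>
    obtain ⟨B, hBA, hcard, hBc⟩ := ih (by lia)
    have hss : B ⊂ A := Finset.ssubset_iff_subset_ne.2 ⟨hBA, by rintro rfl; lia⟩
    obtain ⟨a, ha, b, hbA, hbB, hab⟩ :=
      exists_adj_of_ssubset hA (Finset.card_pos.1 (by lia)) hss
    exact ⟨insert b B, Finset.insert_subset hbA hBA,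
      by rw [Finset.card_insert_of_notMem hbB, hcard], connected_induce_insert hBc ha hab⟩

/-- The bound of Chvátal `R(T, K_m) ≤ (|T| - 1)(m - 1) + 1`, inside a set of vertices. -/
theorem exists_embedsOn_of_card {V U : Type*} {F : SimpleGraph V} (hF : F.IsAcyclic)
    {R B : SimpleGraph U} {A : Finset V} (hA : (F.induce (A : Set V)).Connected) (m : ℕ)
    {S : Finset U} (hS : ∀ x ∈ S, ∀ y ∈ S, x ≠ y → R.Adj x y ∨ B.Adj x y)
    (hB : ∀ t ⊆ S, ¬ B.IsNClique (m + 1) t) (hcard : (A.card - 1) * m + 1 ≤ S.card) :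
    ∃ f : V → U, EmbedsOn F R A S f := by
  classical
  induction m generalizing S with
  | zero =>
    obtain ⟨x, hx⟩ := Finset.card_pos.1 (by lia : 0 < S.card)
    exact (hB {x} (by simpa) (by simp [isNClique_iff])).elim
  | succ m ih =>
    obtain ⟨⟨y, hy⟩⟩ := hA.nonempty
    obtain ⟨w, hw⟩ := Finset.card_pos.1 (by lia : 0 < S.card)
    by_cases hdeg : ∀ u ∈ S, A.card ≤ (S.filter (R.Adj u)).card + 1
    · obtain ⟨f, hf, -⟩ := exists_embedsOn_of_degree hF hA hdeg hy hw
      exact ⟨f, hf⟩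
    push Not at hdeg
    obtain ⟨u, hu, hlt⟩ := hdeg
    -- As `u` has at most `A.card - 2` red neighbours, its blue neighbourhood is large enough for
    -- induction; a clique there extends by `u`.
    have hcov : S ⊆ insert u (S.filter (R.Adj u) ∪ S.filter (B.Adj u)) := by
      intro x hx
      by_cases hxu : x = u
      · simp [hxu]
      · rcases hS u hu x hx (Ne.symm hxu) with h | h <;> simp [hx, h]
    have h1 := (Finset.card_le_card hcov).trans (Finset.card_insert_le _ _)
    have h2 := Finset.card_union_le (S.filter (R.Adj u)) (S.filter (B.Adj u))
    obtain ⟨f, hf⟩ := ih (S := S.filter (B.Adj u))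
      (fun x hx y hy => hS x (Finset.mem_filter.1 hx).1 y (Finset.mem_filter.1 hy).1)
      (fun t ht hc => hB (insert u t)
        (Finset.insert_subset hu (ht.trans (Finset.filter_subset _ _)))
        (hc.insert fun x hx => (Finset.mem_filter.1 (ht hx)).2)) (by
          rw [mul_add] at hcard; lia)
    exact ⟨f, hf.mono (Finset.filter_subset _ _)⟩

/-- The star-critical refinement: one vertex `v` of the host graph may miss `|T| - 2` edges. -/
theorem exists_embedsOn_of_card_of_missing {V U : Type*} {F : SimpleGraph V} (hF : F.IsAcyclic)
    {R B : SimpleGraph U} {A : Finset V} (hA : (F.induce (A : Set V)).Connected)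
    (hA2 : 2 ≤ A.card) (m : ℕ) {S : Finset U} {v : U} (hv : v ∈ S)
    {M : Finset U} (hM : M.card + 2 ≤ A.card)
    (hS : ∀ x ∈ S, ∀ y ∈ S, x ≠ v → y ≠ v → x ≠ y → R.Adj x y ∨ B.Adj x y)
    (hvS : ∀ x ∈ S, x ≠ v → x ∉ M → R.Adj v x ∨ B.Adj v x)
    (hB : ∀ t ⊆ S, ¬ B.IsNClique (m + 2) t) (hcard : (A.card - 1) * (m + 1) + 1 ≤ S.card) :
    ∃ f : V → U, EmbedsOn F R A S f := by
  classical
  rw [mul_add] at hcard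
  set S' := S.erase v with hS'
  have hS'S : S' ⊆ S := Finset.erase_subset _ _
  have hne : ∀ x ∈ S', x ≠ v := fun x hx => (Finset.mem_erase.1 hx).1
  have hcard' : S'.card + 1 = S.card := Finset.card_erase_add_one hv
  -- a vertex with many blue neighbours is enough
  have chv : ∀ u ∈ S, (A.card - 1) * m + 1 ≤ (S'.filter (B.Adj u)).card →
      ∃ f : V → U, EmbedsOn F R A S f := by
    intro u hu hc
    have hsub : S'.filter (B.Adj u) ⊆ S := (Finset.filter_subset _ _).trans hS'S
    obtain ⟨f, hf⟩ := exists_embedsOn_of_card hF hA m (R := R) (B := B)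
      (S := S'.filter (B.Adj u))
      (fun x hx y hy => hS x (hsub hx) y (hsub hy) (hne x (Finset.mem_filter.1 hx).1)
        (hne y (Finset.mem_filter.1 hy).1))
      (fun t ht hc => hB (insert u t) (Finset.insert_subset hu (ht.trans hsub))
        (hc.insert fun x hx => (Finset.mem_filter.1 (ht hx)).2)) hc
    exact ⟨f, hf.mono hsub⟩
  -- Without a red edge at `v`, all but at most `A.card - 2` of the other vertices are blue
  -- neighbours of `v`, enough for `chv`.
  by_cases hw : ∃ w ∈ S', R.Adj v w
  swap
  · push Not at hw
    refine chv v hv ?_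
    have hcov : S' ⊆ M ∪ S'.filter (B.Adj v) := by
      intro x hx
      by_cases hxM : x ∈ M
      · simp [hxM]
      · have := (hvS x (hS'S hx) (hne x hx) hxM).resolve_left (hw x hx)
        simp [hx, this]
    have h1 := (Finset.card_le_card hcov).trans (Finset.card_union_le _ _)
    lia
  obtain ⟨w, hwS, hvw⟩ := hw
  -- The threshold is one lower than for the whole tree: only the tree minus a leaf goes into `S'`.
  -- This makes up for the loss of `v` in the count.
  by_cases hdeg : ∀ u ∈ S', A.card - 1 ≤ (S'.filter (R.Adj u)).card + 1
  swap
  · push Not at hdeg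
    obtain ⟨u, hu, hlt⟩ := hdeg
    refine chv u (hS'S hu) ?_
    have hcov : S' ⊆ insert u (S'.filter (R.Adj u) ∪ S'.filter (B.Adj u)) := by
      intro x hx
      by_cases hxu : x = u
      · simp [hxu]
      · rcases hS u (hS'S hu) x (hS'S hx) (hne u hu) (hne x hx) (Ne.symm hxu) with h | h <;>
          simp [hx, h]
    have h1 := (Finset.card_le_card hcov).trans (Finset.card_insert_le _ _)
    have h2 := Finset.card_union_le (S'.filter (R.Adj u)) (S'.filter (B.Adj u))
    lia
  -- `C` is the tree without a leaf `x`. The neighbour `y` of `x` is sent to `w`, so that `x` can go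
  -- to `v`.
  obtain ⟨C, hCA, hCcard, hC⟩ := exists_connected_subset_card hA (A.card - 2) (by lia)
  have hss : C ⊂ A := Finset.ssubset_iff_subset_ne.2 ⟨hCA, by rintro rfl; lia⟩
  obtain ⟨y, hy, x, hxA, hxC, hyx⟩ := exists_adj_of_ssubset hA (Finset.card_pos.1 (by lia)) hss
  obtain ⟨f, hf, hfy⟩ := exists_embedsOn_of_degree hF hC (R := R) (S := S')
    (fun u hu => by have := hdeg u hu; lia) hy hwS
  have hAeq : insert x C = A := Finset.eq_of_subset_of_card_le
    (Finset.insert_subset hxA hCA) (by rw [Finset.card_insert_of_notMem hxC]; lia)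
  refine ⟨Function.update f x v, ?_⟩
  rw [← hAeq]
  refine hf.update hS'S hxC hv (fun z hz => hne _ (hf.mapsTo z hz)) fun z hz hzx => ?_
  rw [eq_of_adj_of_adj hF hC (by simpa using hxC) hz hy hzx hyx, hfy]
  exact hvw.symm

/-! ### The arrow relation -/

/-- Overlapping colours, or coloured pairs outside `G`, only help to find copies, so covers may
replace labelings. -/
theorem arrows_iff {V W₁ W₂ : Type*} {G : SimpleGraph V} {G₁ : SimpleGraph W₁}
    {G₂ : SimpleGraph W₂} :
    Arrows G G₁ G₂ ↔ ∀ R B : SimpleGraph V, G ≤ R ⊔ B → G₁ ⊑ R ∨ G₂ ⊑ B := by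
  classical
  constructor
  · intro h R B hG
    let c : G.EdgeLabeling (Fin 2) := fun e => if e.1 ∈ R.edgeSet then 0 else 1
    refine (h c).imp (fun h => h.mono_right ?_) (fun h => h.mono_right ?_)
    · intro x y hxy
      obtain ⟨hG', hc⟩ := (EdgeLabeling.labelGraph_adj x y).1 hxy
      by_contra hR
      simp [c, hR] at hc
    · intro x y hxy
      obtain ⟨hG', hc⟩ := (EdgeLabeling.labelGraph_adj x y).1 hxy
      refine (hG hG').resolve_left fun hR => ?_
      simp [c, hR] at hc
  · intro h c
    refine h _ _ fun x y hxy => ?_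
    rw [sup_adj, EdgeLabeling.labelGraph_adj, EdgeLabeling.labelGraph_adj]
    rcases Fin.exists_fin_two.1 (⟨_, rfl⟩ : ∃ i, c ⟨s(x, y), hxy⟩ = i) with h | h
    · exact .inl ⟨hxy, h⟩
    · exact .inr ⟨hxy, h⟩

theorem Arrows.mono {V V' W₁ W₂ : Type*} {G : SimpleGraph V} {G' : SimpleGraph V'}
    {G₁ : SimpleGraph W₁} {G₂ : SimpleGraph W₂} (h : Arrows G G₁ G₂) (hG : G ⊑ G') :
    Arrows G' G₁ G₂ := by
  obtain ⟨f⟩ := hG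
  rw [arrows_iff] at h ⊢
  intro R B hRB
  have hc : ∀ K : SimpleGraph V', K.comap f ⊑ K := fun K =>
    ⟨⟨⟨f, fun h => h⟩, f.injective⟩⟩
  refine (h (R.comap f) (B.comap f) fun x y hxy => ?_).imp (fun h => h.trans (hc R))
    fun h => h.trans (hc B)
  exact hRB (f.toHom.map_adj hxy)

/-! ### Component sizes -/

/-- `tailSum` as a sum over components. -/
theorem tailSum_eq_sum {V : Type*} [Finite V] (F : SimpleGraph V) [Fintype F.ConnectedComponent]
    (j : ℕ) : tailSum F j =
      ∑ c ∈ Finset.univ.filter (fun c : F.ConnectedComponent => j ≤ c.supp.ncard),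
        c.supp.ncard := by
  classical
  have hle : ∀ c : F.ConnectedComponent, c.supp.ncard ≤ maxComponentSize F := fun c =>
    le_ciSup (f := fun c : F.ConnectedComponent => c.supp.ncard) (Set.finite_range _).bddAbove c
  rw [tailSum, ← Finset.sum_fiberwise_of_maps_to (t := Finset.Icc j (maxComponentSize F))
    (g := fun c : F.ConnectedComponent => c.supp.ncard)
    (fun c hc => Finset.mem_Icc.2 ⟨(Finset.mem_filter.1 hc).2, hle c⟩)]
  refine Finset.sum_congr rfl fun i hi => ?_
  have h1 : numComponents F i = (Finset.univ.filter
      (fun c : F.ConnectedComponent => c.supp.ncard = i)).card := by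
    rw [numComponents, ← Set.ncard_coe_finset]
    congr 1
    ext c
    simp
  rw [h1, Finset.filter_filter, Finset.sum_congr rfl
    (fun c hc => (Finset.mem_filter.1 hc).2.2), Finset.sum_const, smul_eq_mul, mul_comm]
  congr 2
  ext c
  simp only [Finset.mem_filter, Finset.mem_univ, true_and]
  have := (Finset.mem_Icc.1 hi).1
  constructor
  · rintro rfl; exact ⟨this, rfl⟩
  · exact fun h => h.2

theorem mem_componentSizes {V : Type*} [Finite V] {F : SimpleGraph V} {i : ℕ} :
    i ∈ componentSizes F ↔ ∃ c : F.ConnectedComponent, c.supp.ncard = i := by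
  change numComponents F i ≠ 0 ↔ _
  rw [numComponents, ← Nat.pos_iff_ne_zero, Set.ncard_pos]
  rfl

theorem two_le_ncard_supp {V : Type*} [Finite V] {F : SimpleGraph V}
    (hiso : ∀ v : V, ¬ F.IsIsolated v) (c : F.ConnectedComponent) : 2 ≤ c.supp.ncard := by
  induction c using ConnectedComponent.ind with
  | h v =>
    obtain ⟨w, hw⟩ := exists_adj_iff_not_isIsolated.2 (hiso v)
    refine (Set.one_lt_ncard_iff).2 ⟨v, w, rfl, ?_, hw.ne⟩
    exact (ConnectedComponent.sound hw.reachable).symm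

/-! ### Upper bound: embedding the forest -/

/-- A forest embeds component by component, in order of decreasing size, into the first colour of
a two-coloured almost complete graph. -/
theorem isContained_of_card {V U : Type*} [Finite V] [Fintype U] {F : SimpleGraph V}
    (hF : F.IsAcyclic) (hiso : ∀ v : V, ¬ F.IsIsolated v) {R B : SimpleGraph U} {m : ℕ}
    (hB : B.CliqueFree (m + 2)) (v : U) (M : Finset U)
    (hRB : ∀ x y, x ≠ v → y ≠ v → x ≠ y → R.Adj x y ∨ B.Adj x y)
    (hv : ∀ x, x ≠ v → x ∉ M → R.Adj v x ∨ B.Adj v x)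
    (hcard : ∀ j ∈ componentSizes F, (j - 1) * m + tailSum F j ≤ Fintype.card U)
    (hM : ∀ j ∈ componentSizes F, (j - 1) * m + tailSum F j = Fintype.card U → M.card + 2 ≤ j) :
    F ⊑ R := by
  classical
  have := Fintype.ofFinite V
  have := Fintype.ofFinite F.ConnectedComponent
  let verts : Finset F.ConnectedComponent → Finset V := fun 𝒞 =>
    Finset.univ.filter fun x => F.connectedComponentMk x ∈ 𝒞
  have hverts : ∀ 𝒞 : Finset F.ConnectedComponent, (verts 𝒞).card = ∑ c ∈ 𝒞, c.supp.ncard := by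
    intro 𝒞
    rw [Finset.card_eq_sum_card_fiberwise (s := verts 𝒞) (t := 𝒞) (f := F.connectedComponentMk)
      (fun x hx => (Finset.mem_filter.1 (Finset.mem_coe.1 hx)).2)]
    refine Finset.sum_congr rfl fun c hc => ?_
    rw [← Set.ncard_coe_finset]
    congr 1
    ext x
    simp only [verts, Finset.coe_filter, Finset.mem_filter, Finset.mem_univ, true_and,
      Set.mem_ofPred_eq, ConnectedComponent.mem_supp_iff]
    exact ⟨fun h => h.2, fun h => ⟨h ▸ hc, h⟩⟩
  suffices H : ∀ 𝒞 : Finset F.ConnectedComponent,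
      ∃ f : V → U, EmbedsOn F R (verts 𝒞) Finset.univ f by
    obtain ⟨f, hf⟩ := H Finset.univ
    have hmem : ∀ x, x ∈ verts Finset.univ := fun x => by simp [verts]
    exact ⟨⟨⟨f, fun {x y} hxy => hf.adj x (hmem x) y (hmem y) hxy⟩,
      fun x y hxy => hf.injOn (hmem x) (hmem y) hxy⟩⟩
  intro 𝒞
  induction 𝒞 using Finset.induction_on_min_value
    (f := fun c : F.ConnectedComponent => c.supp.ncard) with
  | empty =>
    exact ⟨fun _ => v, ⟨by simp, by simp [verts], by simp [verts]⟩⟩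
  | insert c 𝒞 hc hmin ih =>
    obtain ⟨f, hf⟩ := ih
    set A : Finset V := c.supp.toFinset with hAdef
    have hAconn : (F.induce (A : Set V)).Connected := by
      rw [hAdef, Set.coe_toFinset]; exact c.connected_toSimpleGraph
    have hAcard : A.card = c.supp.ncard := (Set.ncard_eq_toFinset_card' _).symm
    have hA2 : 2 ≤ A.card := hAcard ▸ two_le_ncard_supp hiso c
    have hAmem : A.card ∈ componentSizes F := mem_componentSizes.2 ⟨c, hAcard.symm⟩
    set S : Finset U := ((verts 𝒞).image f)ᶜ with hSdef
    have hScard : S.card + (verts 𝒞).card = Fintype.card U := by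
      rw [hSdef, ← hf.card_image]
      exact Finset.card_compl_add_card _
    -- The components already placed are at least as large as `c`, so all of them count in this
    -- tail.
    have htail : (verts 𝒞).card + A.card ≤ tailSum F A.card := by
      rw [tailSum_eq_sum, hverts, add_comm, hAcard,
        ← Finset.sum_insert (f := fun c : F.ConnectedComponent => c.supp.ncard) hc]
      refine Finset.sum_le_sum_of_subset fun d hd => ?_
      rw [Finset.mem_filter]
      refine ⟨Finset.mem_univ _, ?_⟩
      rcases Finset.mem_insert.1 hd with rfl | hd
      exacts [le_rfl, hmin d hd]
    have hj := hcard _ hAmem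
    obtain ⟨g, hg⟩ : ∃ g : V → U, EmbedsOn F R A S g := by
      -- Only if `v` is free and the count is tight must `v` be kept as a possible image.
      by_cases hvS : v ∈ S ∧ (A.card - 1) * m + tailSum F A.card = Fintype.card U
      · refine exists_embedsOn_of_card_of_missing hF hAconn hA2 m hvS.1 (hM _ hAmem hvS.2)
          (fun x _ y _ => hRB x y) (fun x _ => hv x) (fun t _ => hB t) ?_
        rw [mul_add]
        lia
      · obtain ⟨g, hg⟩ := exists_embedsOn_of_card hF hAconn (m + 1) (R := R) (B := B)
          (S := S.erase v) (fun x hx y hy => hRB x y (Finset.ne_of_mem_erase hx)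
            (Finset.ne_of_mem_erase hy)) (fun t _ => hB t) (by
              rw [mul_add]
              by_cases hv' : v ∈ S
              · have := Finset.card_erase_add_one hv'
                have := fun e => hvS ⟨hv', e⟩
                lia
              · rw [Finset.erase_eq_of_notMem hv']
                lia)
        exact ⟨g, hg.mono (Finset.erase_subset _ _)⟩
    have hmemA : ∀ x, x ∈ A ↔ F.connectedComponentMk x = c := fun x => by
      simp [hAdef]
    have hmemV : ∀ x, x ∈ verts 𝒞 ↔ F.connectedComponentMk x ∈ 𝒞 := fun x => by simp [verts]
    have hdisj : ∀ x ∈ A, x ∉ verts 𝒞 := fun x hx hx' => by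
      rw [hmemV, (hmemA x).1 hx] at hx'; exact hc hx'
    have hmem : ∀ x ∈ verts (insert c 𝒞), x ∈ A ∨ (x ∈ verts 𝒞 ∧ x ∉ A) := fun x hx => by
      have : F.connectedComponentMk x ∈ insert c 𝒞 := by simpa [verts] using hx
      rcases Finset.mem_insert.1 this with h | h
      · exact .inl ((hmemA x).2 h)
      · exact .inr ⟨(hmemV x).2 h, fun hA => hdisj x hA ((hmemV x).2 h)⟩
    have hgf : ∀ x ∈ A, ∀ y ∈ verts 𝒞, g x ≠ f y := fun x hx y hy h => by
      have := hg.mapsTo x hx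
      rw [hSdef, Finset.mem_compl, h] at this
      exact this (Finset.mem_image_of_mem f hy)
    have hadj : ∀ x ∈ A, ∀ y ∈ verts 𝒞, ¬ F.Adj x y := fun x hx y hy h => by
      refine hdisj y ((hmemA y).2 ?_) hy
      rw [← (hmemA x).1 hx]
      exact (ConnectedComponent.sound h.reachable).symm
    refine ⟨fun x => if x ∈ A then g x else f x, fun _ _ => Finset.mem_univ _, ?_, ?_⟩
    · intro x hx y hy hxy
      rcases hmem x hx with h1 | h1 <;> rcases hmem y hy with h2 | h2 <;>
        simp only [h1, h2, if_true, if_false] at hxy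
      · exact hg.injOn h1 h2 hxy
      · exact (hgf x h1 y h2.1 hxy).elim
      · exact (hgf y h2 x h1.1 hxy.symm).elim
      · exact hf.injOn h1.1 h2.1 hxy
    · intro x hx y hy hxy
      rcases hmem x hx with h1 | h1 <;> rcases hmem y hy with h2 | h2 <;>
        simp only [h1, h2, if_true, if_false]
      · exact hg.adj x h1 y h2 hxy
      · exact (hadj x h1 y h2.1 hxy).elim
      · exact (hadj y h2 x h1.1 hxy.symm).elim
      · exact hf.adj x h1.1 y h2.1 hxy

/-! ### Lower bound: partition colourings -/

/-- A set of at most `a * b + s` elements splits into `a` classes of size at most `b` and one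
class of size at most `s`. -/
theorem exists_partition {U : Type*} (T : Finset U) (a b s : ℕ) (hT : T.card ≤ a * b + s) :
    ∃ p : U → ℕ, (∀ x, p x ≤ a) ∧ (∀ k < a, (T.filter (p · = k)).card ≤ b) ∧
      (T.filter (p · = a)).card ≤ s := by
  classical
  induction a generalizing T with
  | zero =>
    exact ⟨fun _ => 0, by simp, by simp, (Finset.card_filter_le _ _).trans (by simpa using hT)⟩
  | succ a ih =>
    obtain ⟨C, hCT, hC⟩ := Finset.exists_subset_card_eq (Nat.min_le_right b T.card)
    obtain ⟨p, h1, h2, h3⟩ := ih (T \ C) (by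
      rw [Finset.card_sdiff_of_subset hCT, hC]; rw [add_mul] at hT; lia)
    refine ⟨fun x => if x ∈ C then 0 else p x + 1, fun x => ?_, fun k hk => ?_, ?_⟩
    · have := h1 x
      dsimp only
      split <;> lia
    · rcases k with _ | k
      · refine (Finset.card_le_card (t := C) fun x hx => ?_).trans (hC.trans_le (min_le_left _ _))
        by_contra hx'
        simp [hx'] at hx
      · refine (Finset.card_le_card fun x hx => ?_).trans (h2 k (by lia))
        by_cases hx' : x ∈ C <;> simp_all
    · refine (Finset.card_le_card fun x hx => ?_).trans h3
      by_cases hx' : x ∈ C <;> simp_all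

/-- The colouring behind the lower bounds: the second colour is `(a + 2)`-partite, and the first
colour avoids `Z` and has one large part, too small for the components with at least `j`
vertices. -/
theorem not_arrows_of_partition {V U : Type*} [Finite V] [Fintype U] [DecidableEq U]
    {F : SimpleGraph V} (hiso : ∀ v : V, ¬ F.IsIsolated v) {G : SimpleGraph U} {a j s : ℕ}
    (hj : 1 ≤ j) (Z A : Finset U) (hZ : ∀ x ∈ Z, ∀ y ∈ A ∪ Z, ¬ G.Adj x y) (hA : A.card < j)
    (hs : s < tailSum F j) (hcard : (A ∪ Z)ᶜ.card ≤ a * (j - 1) + s) :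
    ¬ Arrows G F (⊤ : SimpleGraph (Fin (a + 3))) := by
  classical
  have := Fintype.ofFinite V
  have := Fintype.ofFinite F.ConnectedComponent
  obtain ⟨p, hpa, hpk, hps⟩ := exists_partition _ a (j - 1) s hcard
  -- `Z` shares the part of `A`; as `G` has no edge from `Z` to `A ∪ Z`, nothing inside this part at
  -- `Z` needs a colour.
  let q : U → ℕ := fun x => if x ∈ A ∪ Z then a + 1 else p x
  have hq : ∀ x, q x < a + 2 := fun x => by
    have := hpa x
    simp only [q]; split <;> lia
  let R : SimpleGraph U := SimpleGraph.fromRel fun x y => q x = q y ∧ x ∉ Z ∧ y ∉ Z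
  let B : SimpleGraph U := SimpleGraph.fromRel fun x y => q x ≠ q y
  have hR : ∀ {x y}, R.Adj x y → q x = q y ∧ x ∉ Z := by
    rintro x y ⟨-, h | h⟩
    exacts [⟨h.1, h.2.1⟩, ⟨h.1.symm, h.2.2⟩]
  have hB : ∀ {x y}, B.Adj x y → q x ≠ q y := by
    rintro x y ⟨-, h | h⟩
    exacts [h, h.symm]
  rw [arrows_iff]
  intro h
  have hRB : G ≤ R ⊔ B := by
    intro x y hxy
    by_cases hqe : q x = q y
    · by_cases hZZ : x ∉ Z ∧ y ∉ Z
      · exact .inl ⟨hxy.ne, .inl ⟨hqe, hZZ⟩⟩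
      · exfalso
        have key : ∀ {x y}, x ∈ Z → q x = q y → ¬ G.Adj x y := by
          intro x y hx hq
          refine hZ x hx y ?_
          by_contra hy
          simp only [q, Finset.mem_union_right A hx, hy, if_true, if_false] at hq
          have := hpa y
          lia
        rw [not_and_or, not_not, not_not] at hZZ
        rcases hZZ with h | h
        · exact key h hqe hxy
        · exact key h hqe.symm hxy.symm
    · exact .inr ⟨hxy.ne, .inl hqe⟩
  rcases h R B hRB with ⟨⟨f⟩⟩ | ⟨⟨f⟩⟩
  · have hfZ : ∀ x, f x ∉ Z := fun x => by
      obtain ⟨y, hy⟩ := exists_adj_iff_not_isIsolated.2 (hiso x)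
      exact (hR (f.toHom.map_adj hy)).2
    have hreach : ∀ {x y}, F.Reachable x y → q (f x) = q (f y) := by
      rintro x y ⟨w⟩
      induction w with
      | nil => rfl
      | cons hxy _ ih => exact (hR (f.toHom.map_adj hxy)).1.trans ih
    have hlarge : ∀ x, j ≤ (F.connectedComponentMk x).supp.ncard →
        f x ∈ (A ∪ Z)ᶜ.filter (p · = a) := by
      intro x hx
      by_contra hcon
      have hfib : ∃ D : Finset U, D.card < j ∧ ∀ y, F.Reachable y x → f y ∈ D := by
        by_cases hxA : f x ∈ A ∪ Z
        · refine ⟨A, hA, fun y hy => ?_⟩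
          have h1 := hreach hy
          simp only [q, hxA, if_true] at h1
          have h2 : f y ∈ A ∪ Z := by
            by_contra h2
            rw [if_neg h2] at h1
            have := hpa (f y)
            lia
          exact (Finset.mem_union.1 h2).resolve_right (hfZ y)
        · have hpx : p (f x) ≠ a := fun e =>
            hcon (Finset.mem_filter.2 ⟨Finset.mem_compl.2 hxA, e⟩)
          have hlt : p (f x) < a := lt_of_le_of_ne (hpa _) hpx
          refine ⟨(A ∪ Z)ᶜ.filter (p · = p (f x)), by have := hpk _ hlt; lia, fun y hy => ?_⟩
          have h1 := hreach hy
          simp only [q, hxA, if_false] at h1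
          have h2 : f y ∉ A ∪ Z := by
            intro h2
            rw [if_pos h2] at h1
            lia
          rw [if_neg h2] at h1
          exact Finset.mem_filter.2 ⟨Finset.mem_compl.2 h2, h1⟩
      obtain ⟨D, hD, hmap⟩ := hfib
      have : (F.connectedComponentMk x).supp.ncard ≤ (D : Set U).ncard :=
        Set.ncard_le_ncard_of_injOn f (fun y hy => hmap y (ConnectedComponent.exact hy))
          f.injective.injOn
      rw [Set.ncard_coe_finset] at this
      lia
    have hle : tailSum F j ≤ ((A ∪ Z)ᶜ.filter (p · = a)).card := by
      have h1 : tailSum F j = (Finset.univ.filter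
          fun x => j ≤ (F.connectedComponentMk x).supp.ncard).card := by
        rw [tailSum_eq_sum, Finset.card_eq_sum_card_fiberwise (f := F.connectedComponentMk)
          (t := Finset.univ.filter fun c : F.ConnectedComponent => j ≤ c.supp.ncard)
          (fun x hx => by simpa using hx)]
        refine Finset.sum_congr rfl fun c hc => ?_
        rw [← Set.ncard_coe_finset]
        congr 1
        ext x
        have := (Finset.mem_filter.1 hc).2
        simp only [Finset.coe_filter, Finset.mem_filter, Finset.mem_univ, true_and,
          Set.mem_ofPred_eq, ConnectedComponent.mem_supp_iff]
        exact ⟨fun h => ⟨h ▸ this, h⟩, fun h => h.2⟩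
      rw [h1]
      exact Finset.card_le_card_of_injOn f (fun x hx => hlarge x (by simpa using hx))
        f.injective.injOn
    lia
  · let g : Fin (a + 3) → Fin (a + 2) := fun i => ⟨q (f i), hq _⟩
    obtain ⟨x, y, hxy, he⟩ := Fintype.exists_ne_map_eq_of_card_lt g (by simp)
    exact hB (f.toHom.map_adj (show (⊤ : SimpleGraph (Fin (a + 3))).Adj x y from hxy))
      (congrArg Fin.val he)

end ForestRamsey

open ForestRamsey

/-! ### The star-critical Ramsey number -/

theorem mainTheorem2 {V : Type*} [Finite V] (F : SimpleGraph V) (hF : F.IsAcyclic)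
    (hiso : ∀ v : V, ¬ F.IsIsolated v) (m : ℕ) (hm : 3 ≤ m) (j₀ : ℕ)
    (hj₀ : ForestRamsey.IsSmallestMaximizer F m j₀) :
    ForestRamsey.IsStarCriticalRamseyNumber F (⊤ : SimpleGraph (Fin m))
      ((j₀ - 1) * (m - 3) + ForestRamsey.tailSum F j₀) := by
  classical
  obtain ⟨a, rfl⟩ := Nat.exists_eq_add_of_le' hm
  obtain ⟨⟨hjC, hmax⟩, hleast⟩ := hj₀
  rw [show a + 3 - 3 = a by lia]
  rw [show a + 3 - 2 = a + 1 by lia] at *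
  obtain ⟨c, hc⟩ := mem_componentSizes.1 hjC
  have hj2 : 2 ≤ j₀ := hc ▸ two_le_ncard_supp hiso c
  have htail : j₀ ≤ tailSum F j₀ := by
    have := Fintype.ofFinite F.ConnectedComponent
    rw [tailSum_eq_sum]
    refine hc.symm.le.trans (Finset.single_le_sum
      (f := fun c : F.ConnectedComponent => c.supp.ncard) (fun _ _ => Nat.zero_le _) ?_)
    simp [hc]
  obtain ⟨r, hr⟩ : ∃ r, r = (j₀ - 1) * (a + 1) + tailSum F j₀ := ⟨_, rfl⟩
  have hr' : r = (j₀ - 1) * a + tailSum F j₀ + (j₀ - 1) := by rw [hr]; ring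
  have hcardle : ∀ j ∈ componentSizes F, (j - 1) * (a + 1) + tailSum F j ≤ r :=
    fun j hj => (hmax hj).trans hr.ge
  -- The choice of the smallest maximizer matters here: it is what allows `j₀ - 2` edges at `v` to
  -- be deleted.
  have hcardeq : ∀ j ∈ componentSizes F, (j - 1) * (a + 1) + tailSum F j = r → j₀ ≤ j :=
    fun j hj h => hleast ⟨hj, fun i hi => (hcardle i hi).trans h.ge⟩
  -- the host graph
  let v : Fin r := ⟨0, by lia⟩
  obtain ⟨M, hMsub, hMcard⟩ := Finset.exists_subset_card_eq
    (s := (Finset.univ : Finset (Fin r)).erase v) (n := j₀ - 2) (by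
      rw [Finset.card_erase_of_mem (Finset.mem_univ _), Finset.card_univ, Fintype.card_fin]; lia)
  let X : SimpleGraph (Fin r) :=
    SimpleGraph.fromRel fun x y => ¬ (x = v ∧ y ∈ M) ∧ ¬ (y = v ∧ x ∈ M)
  have hX : Arrows X F (⊤ : SimpleGraph (Fin (a + 3))) := by
    rw [arrows_iff]
    intro R B hRB
    by_contra hcon
    rw [not_or] at hcon
    refine hcon.1 (isContained_of_card hF hiso (B := B) (m := a + 1) ?_ v M ?_ ?_ ?_ ?_)
    · by_contra h
      exact hcon.2 ((not_cliqueFree_iff_top_isContained _).1 h)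
    · intro x y hx hy hxy
      exact hRB (show X.Adj x y from ⟨hxy, .inl ⟨fun h => hx h.1, fun h => hy h.1⟩⟩)
    · intro x hx hxM
      exact hRB (show X.Adj v x from ⟨hx.symm, .inl ⟨fun h => hxM h.2, fun h => hx h.1⟩⟩)
    · simpa using hcardle
    · intro j hj h
      have := hcardeq j hj (by simpa using h)
      lia
  have hlower : ∀ {U : Type} [Fintype U] (G : SimpleGraph U), Fintype.card U < r →
      ¬ Arrows G F (⊤ : SimpleGraph (Fin (a + 3))) := by
    intro U _ G hU
    obtain ⟨A, -, hA⟩ := Finset.exists_subset_card_eq (s := (Finset.univ : Finset U))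
      (Nat.min_le_right (j₀ - 1) _)
    rw [Finset.card_univ] at hA
    refine not_arrows_of_partition hiso (j := j₀) (s := tailSum F j₀ - 1) (by lia) ∅ A (by simp)
      (by lia) (by lia) ?_
    rw [Finset.union_empty, Finset.card_compl, hA, mul_comm a]
    lia
  have hdeg : ∀ {U : Type} [Fintype U] (G : SimpleGraph U) [DecidableRel G.Adj],
      Fintype.card U ≤ r → Arrows G F (⊤ : SimpleGraph (Fin (a + 3))) →
      (j₀ - 1) * a + tailSum F j₀ ≤ G.minDegree := by
    intro U _ G _ hHr' hH
    -- Subgraphs of K_r need not be spanning; one that arrows has all `r` vertices.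
    have hHr : r ≤ Fintype.card U := by
      by_contra h
      exact hlower _ (by lia) hH
    have : Nonempty U := Fintype.card_pos_iff.1 (by lia)
    obtain ⟨u, hu⟩ := G.exists_minimal_degree_vertex
    rw [hu]
    by_contra! hlt
    have hNcard : (insert u (G.neighborFinset u))ᶜ.card + (G.degree u + 1) =
        Fintype.card U := by
      rw [← card_neighborFinset_eq_degree,
        ← Finset.card_insert_of_notMem (G.notMem_neighborFinset_self u)]
      exact Finset.card_compl_add_card _
    obtain ⟨A, hAsub, hA⟩ := Finset.exists_subset_card_eq
      (s := (insert u (G.neighborFinset u))ᶜ) (n := j₀ - 1) (by lia)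
    have hAu : ∀ x ∈ A, x ≠ u ∧ ¬ G.Adj u x := fun x hx => by
      simpa using hAsub hx
    refine not_arrows_of_partition hiso (G := G) (j := j₀) (s := tailSum F j₀ - 1) (a := a)
      (by lia) {u} A ?_ (by lia) (by lia) ?_ hH
    · intro x hx y hy
      obtain rfl := Finset.mem_singleton.1 hx
      rcases Finset.mem_union.1 hy with hy | hy
      · exact (hAu y hy).2
      · obtain rfl := Finset.mem_singleton.1 hy
        exact G.irrefl
    · have h1 : (A ∪ {u}).card = j₀ := by
        rw [Finset.card_union_of_disjoint (by
          simpa using fun h => (hAu u h).1 rfl), hA, Finset.card_singleton]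
        lia
      rw [Finset.card_compl, h1, mul_comm a]
      lia
  have hdegH : ∀ H : (⊤ : SimpleGraph (Fin r)).Subgraph, Fintype.card H.verts ≤ r := fun H => by
    simpa using Fintype.card_subtype_le (· ∈ H.verts)
  refine ⟨r, ⟨⟨by lia, hX.mono (IsContained.of_le le_top)⟩, fun n hn => ?_⟩, ?_, ?_⟩
  · by_contra h
    exact hlower _ (by simpa using h) hn.2
  · let H : (⊤ : SimpleGraph (Fin r)).Subgraph := toSubgraph X le_top
    have hXH : X ⊑ H.coe :=
      ⟨⟨⟨fun x => ⟨x, trivial⟩, fun h => h⟩, fun x y h => congrArg Subtype.val h⟩⟩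
    refine ⟨H, hX.mono hXH, le_antisymm ?_ (hdeg _ (hdegH H) (hX.mono hXH))⟩
    refine (minDegree_le_degree _ ⟨v, trivial⟩).trans ?_
    rw [← card_neighborFinset_eq_degree]
    have h1 : ((Finset.univ : Finset (Fin r)).erase v \ M).card =
        (j₀ - 1) * a + tailSum F j₀ := by
      rw [Finset.card_sdiff_of_subset hMsub, Finset.card_erase_of_mem (Finset.mem_univ _),
        Finset.card_univ, Fintype.card_fin]
      lia
    rw [← h1]
    refine Finset.card_le_card_of_injOn Subtype.val (fun x hx => ?_)
      Subtype.val_injective.injOn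
    have hvx : X.Adj v x := by rwa [Finset.mem_coe, mem_neighborFinset] at hx
    obtain ⟨hne, h⟩ := hvx
    simp only [Finset.coe_sdiff, Set.mem_sdiff, Finset.mem_coe, Finset.mem_erase,
      Finset.mem_univ, and_true]
    refine ⟨hne.symm, fun hM => ?_⟩
    rcases h with h | h
    exacts [h.1 ⟨rfl, hM⟩, h.2 ⟨rfl, hM⟩]
  · rintro d ⟨H, hH, rfl⟩
    exact hdeg _ (hdegH H) hH
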